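/- Let $1<p<2$, and let $\{X_n,\ n\ge 1\}$ be a sequence of real random variables on a probability space $(\Omega,\mathcal F,\mathbb P)$ that is pairwise negatively quadrant dependent, that is, $$\mathbb P\{X_k\le x,\ X_j\le y\}\le \mathbb P\{X_k\le x\}\,\mathbb P\{X_j\le y\}\qquad\text{for all } x,y\in\mathbb R \text{ and all integers } k,j\ge 1 \text{ with } k\ne j.$$ Suppose that the sequence is stochastically dominated by a random variable $X$ on the same space with $\mathbb E|X|^p<\infty$, that is, there is a constant $C>0$ such that $$\sup_{n\ge 1}\mathbb P\{|X_n|>t\}\le C\,\mathbb P\{|X|>t\}\qquad\text{for every } t>0.$$ Write $\operatorname{LLog} x=\log\log\max\{x,\mathrm e^{\mathrm e}\}$. Then every $X_n$ is integrable and $$\frac{1}{n^{1/p}(\operatorname{LLog} n)^{2(p-1)/p}}\sum_{k=1}^{n}(X_k-\mathbb E X_k)\longrightarrow 0\qquad\text{almost surely as } n\to\infty.$$ -/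

import Mathlib

open MeasureTheory Filter Topology

/-- `LLog x = log log max {x, e ^ e}`. -/
noncomputable def LLog (x : ℝ) : ℝ :=
  Real.log (Real.log (max x (Real.exp (Real.exp 1))))

/-- The sequence `X 1, X 2, …` is pairwise negatively quadrant dependent. The entry `X 0` plays
no role. -/
def PairwiseNQD {Ω : Type*} [MeasurableSpace Ω] (μ : Measure Ω) (X : ℕ → Ω → ℝ) : Prop :=
  ∀ k j : ℕ, 1 ≤ k → 1 ≤ j → k ≠ j → ∀ x y : ℝ,
    μ.real {ω | X k ω ≤ x ∧ X j ω ≤ y} - μ.real {ω | X k ω ≤ x} * μ.real {ω | X j ω ≤ y} ≤ 0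

/-- The sequence `X 1, X 2, …` is stochastically dominated by `Y`: for some constant `C > 0`,
`P (|X n| > t) ≤ C * P (|Y| > t)` for all `n ≥ 1` and all `t > 0`. The entry `X 0` plays
no role. -/
def StochDominatedBy {Ω : Type*} [MeasurableSpace Ω] (μ : Measure Ω) (X : ℕ → Ω → ℝ)
    (Y : Ω → ℝ) : Prop :=
  ∃ C : ℝ, 0 < C ∧ ∀ t : ℝ, 0 < t → ∀ n : ℕ, 1 ≤ n →
    μ.real {ω | t < |X n ω|} ≤ C * μ.real {ω | t < |Y ω|}

/-! The iterated logarithm is not needed: the centred sums divided by n^(1/p) alone tend to 0, and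
`LLog` is at least 1. Positive and negative parts inherit a joint tail inequality, so nonnegative
V_i suffice (`ae_tendsto_sum_range_div_rpow_of_nonneg`). By Hoeffding's layer-cake argument the
layers min(V_i, b) - min(V_i, a) are pairwise nonpositively correlated, so the variance of a block
sum is at most the sum of the second moments.

A Rademacher–Menshov bound for the maximum over j < 2^n would cost a logarithm. Instead the
truncation level follows the scale: with β = 2^(1/p), blocks of length 2^k see V_i cut at β^k
(`abs_sum_range_le_chaining`). Raising the level from β^k to β^(k+1) adds nonnegative increments, so
an incomplete block is controlled by the complete one, at the price of means (`abs_sum_Ico_sub_le`).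

Let g_k and ε_k bound E min(V_i, β^k)^2 and E (V_i - β^k)^+. The square sum at scale k has mean at
most 2^n g_k, which divided by β^(2n) is r^(n-k) · r^k g_k with r = 2/β^2 < 1, since p < 2.
Cauchy–Schwarz with geometric weights then leaves a convolution of summable sequences
(`ae_tendsto_chainingSquareSum`). The p-th moment makes r^k g_k and (2/β)^k ε_k summable. -/

/-! ### Truncated geometric series and the p-th moment -/

/-- A truncated geometric series with ratio `g > 1`, restricted to the terms below `w`. -/
lemma sum_range_geom_ite_le {g w : ℝ} (hg : 1 < g) (hw : 0 ≤ w) (N : ℕ) :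
    ∑ k ∈ Finset.range N, (if g ^ k ≤ w then g ^ k else 0) ≤ g / (g - 1) * w := by
  have hg' : 0 < g - 1 := by linarith
  induction N with
  | zero => simp; positivity
  | succ N ih =>
    by_cases h : g ^ N ≤ w
    · calc ∑ k ∈ Finset.range (N + 1), (if g ^ k ≤ w then g ^ k else 0)
          ≤ ∑ k ∈ Finset.range (N + 1), g ^ k := by
            refine Finset.sum_le_sum fun k _ => ?_
            split_ifs
            · exact le_rfl
            · positivity
        _ = (g ^ (N + 1) - 1) / (g - 1) := geom_sum_eq hg.ne' _
        _ ≤ g * w / (g - 1) := by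
            gcongr
            have : g * g ^ N ≤ g * w := by gcongr
            rw [pow_succ]
            linarith
        _ = g / (g - 1) * w := by ring
    · rw [Finset.sum_range_succ, if_neg h, add_zero]
      exact ih

/-- A truncated geometric series with ratio `r < 1`, restricted to the terms below `w`. -/
lemma sum_range_geom_ite_le_of_lt_one {r : ℝ} (hr0 : 0 < r) (hr : r < 1) (N : ℕ) {w : ℝ}
    (hw : 0 ≤ w) :
    ∑ k ∈ Finset.range N, (if r ^ k ≤ w then r ^ k else 0) ≤ w / (1 - r) := by
  have hr' : 0 < 1 - r := by linarith
  induction N generalizing w with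
  | zero => simp; positivity
  | succ N ih =>
    by_cases h : 1 ≤ w
    · calc ∑ k ∈ Finset.range (N + 1), (if r ^ k ≤ w then r ^ k else 0)
          ≤ ∑ k ∈ Finset.range (N + 1), r ^ k := by
            refine Finset.sum_le_sum fun k _ => ?_
            split_ifs
            · exact le_rfl
            · positivity
        _ ≤ ∑' k, r ^ k :=
            (summable_geometric_of_lt_one hr0.le hr).sum_le_tsum _ fun _ _ => by positivity
        _ = 1 / (1 - r) := by rw [tsum_geometric_of_lt_one hr0.le hr, one_div]
        _ ≤ w / (1 - r) := by gcongr
    -- For w < 1 the term k = 0 drops out, and shifting the index replaces w by w / r.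
    · rw [Finset.sum_range_succ', pow_zero, if_neg h, add_zero]
      have := ih (w := w / r) (by positivity)
      calc ∑ k ∈ Finset.range N, (if r ^ (k + 1) ≤ w then r ^ (k + 1) else 0)
          = r * ∑ k ∈ Finset.range N, (if r ^ k ≤ w / r then r ^ k else 0) := by
            rw [Finset.mul_sum]
            refine Finset.sum_congr rfl fun k _ => ?_
            simp only [le_div_iff₀ hr0, ← pow_succ]
            split_ifs
            · ring
            · ring
        _ ≤ r * (w / r / (1 - r)) := by gcongr
        _ = w / (1 - r) := by field_simp

section base

variable {p : ℝ}

lemma one_lt_two_rpow_inv (hp1 : 1 < p) : (1 : ℝ) < 2 ^ (1 / p) :=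
  Real.one_lt_rpow (by norm_num) (by positivity)

lemma two_rpow_inv_lt_two (hp1 : 1 < p) : (2 : ℝ) ^ (1 / p) < 2 := by
  have : (2 : ℝ) ^ (1 / p) < 2 ^ (1 : ℝ) :=
    Real.rpow_lt_rpow_of_exponent_lt (by norm_num) (by rw [div_lt_one (by linarith)]; exact hp1)
  simpa using this

lemma two_lt_two_rpow_inv_sq (hp1 : 1 < p) (hp2 : p < 2) : (2 : ℝ) < (2 ^ (1 / p)) ^ 2 := by
  rw [← Real.rpow_natCast, ← Real.rpow_mul (by norm_num)]
  have : (2 : ℝ) ^ (1 : ℝ) < 2 ^ (1 / p * (2 : ℕ)) := by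
    refine Real.rpow_lt_rpow_of_exponent_lt (by norm_num) ?_
    have h0 : 0 < p := by linarith
    push_cast
    rw [one_div, inv_mul_eq_div, one_lt_div h0]
    exact hp2
  simpa using this

lemma two_rpow_inv_pow_rpow (hp1 : 1 < p) (k : ℕ) : (((2 : ℝ) ^ (1 / p)) ^ k) ^ p = 2 ^ k := by
  have h0 : p ≠ 0 := by linarith
  rw [← Real.rpow_natCast, ← Real.rpow_mul (by positivity), ← Real.rpow_mul (by positivity),
    ← Real.rpow_natCast]
  congr 1
  field_simp

/-- With β = 2^(1/p) and r = 2/β^2, the summand is 2^k = (β^k)^p as long as β^k ≤ y, and r^k y^2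
with r^k = (β^k)^(p-2) afterwards. Both pieces are geometric and comparable to their extreme term,
of order y^p. -/
lemma sum_range_mul_min_sq_le (hp1 : 1 < p) (hp2 : p < 2) :
    ∃ c : ℝ, ∀ y : ℝ, 0 ≤ y → ∀ N : ℕ,
      ∑ k ∈ Finset.range N, (2 / ((2 : ℝ) ^ (1 / p)) ^ 2) ^ k * (min y ((2 ^ (1 / p)) ^ k)) ^ 2
        ≤ c * y ^ p := by
  have hβ1 := one_lt_two_rpow_inv hp1
  have hβ2 := two_lt_two_rpow_inv_sq hp1 hp2
  have hβp := two_rpow_inv_pow_rpow hp1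
  set β : ℝ := 2 ^ (1 / p)
  have hβ0 : 0 < β := by linarith
  set r : ℝ := 2 / β ^ 2 with hr
  have hr0 : 0 < r := by positivity
  have hr1 : r < 1 := by rw [hr, div_lt_one (by positivity)]; exact hβ2
  have hrβ (k : ℕ) : r ^ k * (β ^ k) ^ 2 = 2 ^ k := by
    rw [← pow_mul, mul_comm k 2, pow_mul, ← mul_pow, hr, div_mul_cancel₀ _ (by positivity)]
  refine ⟨2 / (2 - 1) + 1 / (1 - r), fun y hy N => ?_⟩
  rcases hy.eq_or_lt with rfl | hy0
  · have : ∀ k, min 0 (β ^ k) = 0 := fun k => min_eq_left (by positivity)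
    simp only [this]
    rw [Real.zero_rpow (by linarith)]
    simp
  have h1 := sum_range_geom_ite_le (g := 2) (w := y ^ p) (by norm_num) (by positivity) N
  have h2 := sum_range_geom_ite_le_of_lt_one hr0 hr1 N (w := y ^ (p - 2)) (by positivity)
  have hpp : y ^ (p - 2) * y ^ 2 = y ^ p := by
    rw [← Real.rpow_natCast, ← Real.rpow_add hy0]
    congr 1
    push_cast
    ring
  calc ∑ k ∈ Finset.range N, r ^ k * (min y (β ^ k)) ^ 2
      ≤ ∑ k ∈ Finset.range N, ((if (2 : ℝ) ^ k ≤ y ^ p then (2 : ℝ) ^ k else 0)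
          + (if r ^ k ≤ y ^ (p - 2) then r ^ k else 0) * y ^ 2) := by
        refine Finset.sum_le_sum fun k _ => ?_
        rcases le_or_gt (β ^ k) y with h | h
        · rw [min_eq_right h, hrβ, if_pos]
          · have : 0 ≤ (if r ^ k ≤ y ^ (p - 2) then r ^ k else 0) * y ^ 2 := by
              split_ifs <;> positivity
            linarith
          · rw [← hβp k]
            exact Real.rpow_le_rpow (by positivity) h (by linarith)
        · have hle : r ^ k ≤ y ^ (p - 2) := by
            have h3 : (β ^ k) ^ (p - 2) ≤ y ^ (p - 2) :=
              Real.rpow_le_rpow_of_nonpos hy0 h.le (by linarith)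
            refine le_trans (le_of_eq ?_) h3
            rw [Real.rpow_sub (by positivity), hβp, eq_div_iff (by positivity), ← hrβ k]
            norm_cast
          rw [min_eq_left h.le, if_pos hle]
          have : 0 ≤ (if (2 : ℝ) ^ k ≤ y ^ p then (2 : ℝ) ^ k else 0) := by
            split_ifs <;> positivity
          linarith
    _ ≤ 2 / (2 - 1) * y ^ p + y ^ (p - 2) / (1 - r) * y ^ 2 := by
        rw [Finset.sum_add_distrib, ← Finset.sum_mul]
        gcongr
    _ = (2 / (2 - 1) + 1 / (1 - r)) * y ^ p := by
        rw [← hpp]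
        ring

/-- Only the k with β^k < y contribute; there (2/β)^k = (β^k)^(p-1) ≤ y^(p-1). The ratio 2/β exceeds
1 because p > 1, so the last term dominates. -/
lemma sum_range_mul_posPart_sub_le (hp1 : 1 < p) :
    ∃ c : ℝ, ∀ y : ℝ, 0 ≤ y → ∀ N : ℕ,
      ∑ k ∈ Finset.range N, (2 / (2 : ℝ) ^ (1 / p)) ^ k * max (y - (2 ^ (1 / p)) ^ k) 0
        ≤ c * y ^ p := by
  have hβ1 := one_lt_two_rpow_inv hp1
  have hβ2 := two_rpow_inv_lt_two hp1
  have hβp := two_rpow_inv_pow_rpow hp1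
  set β : ℝ := 2 ^ (1 / p)
  have hβ0 : 0 < β := by linarith
  set g : ℝ := 2 / β with hg
  have hg1 : 1 < g := by rw [hg, one_lt_div hβ0]; exact hβ2
  have hg0 : 0 < g := by linarith
  refine ⟨g / (g - 1), fun y hy N => ?_⟩
  rcases hy.eq_or_lt with rfl | hy0
  · have : ∀ k, max (0 - β ^ k) 0 = 0 := fun k => max_eq_right (by simp; positivity)
    simp only [this]
    rw [Real.zero_rpow (by linarith)]
    simp
  have h1 := sum_range_geom_ite_le hg1 (w := y ^ (p - 1)) (by positivity) N
  calc ∑ k ∈ Finset.range N, g ^ k * max (y - β ^ k) 0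
      ≤ ∑ k ∈ Finset.range N, (if g ^ k ≤ y ^ (p - 1) then g ^ k else 0) * y := by
        refine Finset.sum_le_sum fun k _ => ?_
        have hk : 0 < β ^ k := by positivity
        rcases le_or_gt (β ^ k) y with h | h
        · rw [if_pos]
          · gcongr
            exact max_le (by linarith) hy
          · have h3 : (β ^ k) ^ (p - 1) ≤ y ^ (p - 1) :=
              Real.rpow_le_rpow hk.le h (by linarith)
            refine le_trans (le_of_eq ?_) h3
            rw [Real.rpow_sub hk, hβp, hg, div_pow, Real.rpow_one]
        · rw [max_eq_right (by linarith), mul_zero]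
          split_ifs <;> positivity
    _ ≤ g / (g - 1) * y ^ (p - 1) * y := by
        rw [← Finset.sum_mul]
        gcongr
    _ = g / (g - 1) * y ^ p := by
        rw [mul_assoc, ← Real.rpow_add_one hy0.ne']
        simp

end base

/-! ### Convolutions and deterministic dyadic chaining -/

/-- The convolution of two nonnegative summable sequences is summable. -/
lemma summable_sum_range_mul_sub {a b : ℕ → ℝ} (ha0 : ∀ n, 0 ≤ a n) (hb0 : ∀ n, 0 ≤ b n)
    (ha : Summable a) (hb : Summable b) :
    Summable fun n => ∑ k ∈ Finset.range n, a k * b (n - k) := by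
  have h := summable_norm_sum_mul_range_of_summable_norm ha.norm hb.norm
  refine Summable.of_nonneg_of_le
    (fun n => Finset.sum_nonneg fun k _ => mul_nonneg (ha0 _) (hb0 _)) (fun n => ?_) h
  rw [Finset.sum_range_succ, Real.norm_eq_abs]
  exact (le_add_of_nonneg_right (mul_nonneg (ha0 _) (hb0 _))).trans (le_abs_self _)

/-- The sum of `f` over the `m`-th dyadic block of length `2 ^ k`. -/
def dyadicBlockSum (f : ℕ → ℝ) (k m : ℕ) : ℝ :=
  ∑ i ∈ Finset.Ico (m * 2 ^ k) ((m + 1) * 2 ^ k), f i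

/-- The sum of the squares of the dyadic block sums at scale `k` inside `[0, 2 ^ n)`. -/
def dyadicSquareSum (f : ℕ → ℝ) (n k : ℕ) : ℝ :=
  ∑ m ∈ Finset.range (2 ^ (n - k)), dyadicBlockSum f k m ^ 2

lemma dyadicSquareSum_nonneg (f : ℕ → ℝ) (n k : ℕ) : 0 ≤ dyadicSquareSum f n k :=
  Finset.sum_nonneg fun _ _ => sq_nonneg _

lemma abs_dyadicBlockSum_le_sqrt (f : ℕ → ℝ) {n k m : ℕ} (hm : m < 2 ^ (n - k)) :
    |dyadicBlockSum f k m| ≤ √(dyadicSquareSum f n k) := by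
  refine Real.abs_le_sqrt ?_
  exact Finset.single_le_sum (f := fun m => dyadicBlockSum f k m ^ 2)
    (fun _ _ => sq_nonneg _) (Finset.mem_range.2 hm)

/-- Telescoping in k, where j is rounded down to a multiple of 2^k while the summand passes from
level k to level k + 1. The first bracket moves the endpoint at a fixed level; the second changes
the level on the remainder of j modulo 2^(k+1). -/
lemma sum_range_eq_sum_chain (z : ℕ → ℕ → ℝ) (j n : ℕ) :
    ∑ i ∈ Finset.range j, z n i - ∑ i ∈ Finset.range (j / 2 ^ n * 2 ^ n), z n i =
      ∑ k ∈ Finset.range n,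
        ((∑ i ∈ Finset.range (j / 2 ^ k * 2 ^ k), z k i
          - ∑ i ∈ Finset.range (j / 2 ^ (k + 1) * 2 ^ (k + 1)), z k i)
        + ((∑ i ∈ Finset.range j, z (k + 1) i - ∑ i ∈ Finset.range j, z k i)
          - (∑ i ∈ Finset.range (j / 2 ^ (k + 1) * 2 ^ (k + 1)), z (k + 1) i
            - ∑ i ∈ Finset.range (j / 2 ^ (k + 1) * 2 ^ (k + 1)), z k i))) := by
  induction n with
  | zero => simp
  | succ n ih =>
    rw [Finset.sum_range_succ, ← ih]
    ring

lemma div_two_pow_lt {j n k : ℕ} (hj : j < 2 ^ n) (hk : k ≤ n) : j / 2 ^ k < 2 ^ (n - k) := by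
  rw [Nat.div_lt_iff_lt_mul (by positivity), ← pow_add, Nat.sub_add_cancel hk]
  exact hj

/-- The two rounded endpoints coincide or differ by exactly one block of length 2^k. Bounding that
block by the square sum over all blocks makes the estimate uniform in j. -/
lemma abs_sum_range_sub_le_sqrt (f : ℕ → ℝ) {j n k : ℕ} (hj : j < 2 ^ n) (hk : k < n) :
    |∑ i ∈ Finset.range (j / 2 ^ k * 2 ^ k), f i
      - ∑ i ∈ Finset.range (j / 2 ^ (k + 1) * 2 ^ (k + 1)), f i| ≤ √(dyadicSquareSum f n k) := by
  have hq : j / 2 ^ (k + 1) = j / 2 ^ k / 2 := by rw [pow_succ, Nat.div_div_eq_div_mul]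
  have hlt := div_two_pow_lt hj hk.le
  rw [hq]
  set q := j / 2 ^ k
  rcases Nat.even_or_odd' q with ⟨c, hc | hc⟩
  · have : q / 2 * 2 ^ (k + 1) = q * 2 ^ k := by
      rw [hc, Nat.mul_div_cancel_left _ (by norm_num)]
      ring
    rw [this, sub_self, abs_zero]
    positivity
  · have h2 : q / 2 * 2 ^ (k + 1) = (q - 1) * 2 ^ k := by
      rw [show q / 2 = c by omega, show q - 1 = 2 * c by omega]
      ring
    rw [h2, ← Finset.sum_Ico_eq_sub _ (Nat.mul_le_mul_right _ (by omega))]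
    have := abs_dyadicBlockSum_le_sqrt f (n := n) (k := k) (m := q - 1) (by omega)
    rwa [dyadicBlockSum, show q - 1 + 1 = q by omega] at this

/-- Positivity replaces a maximal inequality: |d - e| ≤ d + e may be summed over the complete block
containing j, and d + e = (d - e) + 2e. In the application d is an increment of truncations and e
its mean. -/
lemma abs_sum_Ico_sub_le {d e : ℕ → ℝ} (hd : ∀ i, 0 ≤ d i) (he : ∀ i, 0 ≤ e i) {ε : ℝ}
    (heε : ∀ i, e i ≤ ε) {j n k : ℕ} (hj : j < 2 ^ n) (hk : k ≤ n) :
    |∑ i ∈ Finset.range j, (d i - e i) - ∑ i ∈ Finset.range (j / 2 ^ k * 2 ^ k), (d i - e i)|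
      ≤ √(dyadicSquareSum (fun i => d i - e i) n k) + 2 * (2 ^ k * ε) := by
  have hlt := div_two_pow_lt hj hk
  have hle : j / 2 ^ k * 2 ^ k ≤ j := Nat.div_mul_le_self _ _
  have hge : j ≤ (j / 2 ^ k + 1) * 2 ^ k :=
    ((Nat.div_lt_iff_lt_mul (by positivity)).1 (Nat.lt_succ_self _)).le
  have hblock := (le_abs_self _).trans
    (abs_dyadicBlockSum_le_sqrt (fun i => d i - e i) hlt)
  rw [← Finset.sum_Ico_eq_sub _ hle]
  set q := j / 2 ^ k
  have hsum : ∑ i ∈ Finset.Ico (q * 2 ^ k) ((q + 1) * 2 ^ k), e i ≤ 2 ^ k * ε := by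
    refine (Finset.sum_le_card_nsmul _ _ ε fun i _ => heε i).trans (le_of_eq ?_)
    rw [Nat.card_Ico, ← Nat.sub_mul, Nat.add_sub_cancel_left, one_mul, nsmul_eq_mul]
    push_cast
    rfl
  calc |∑ i ∈ Finset.Ico (q * 2 ^ k) j, (d i - e i)|
      ≤ ∑ i ∈ Finset.Ico (q * 2 ^ k) j, |d i - e i| := Finset.abs_sum_le_sum_abs _ _
    _ ≤ ∑ i ∈ Finset.Ico (q * 2 ^ k) j, (d i + e i) := by
        refine Finset.sum_le_sum fun i _ => abs_le.2 ⟨?_, ?_⟩ <;> linarith [hd i, he i]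
    _ ≤ ∑ i ∈ Finset.Ico (q * 2 ^ k) ((q + 1) * 2 ^ k), (d i + e i) :=
        Finset.sum_le_sum_of_subset_of_nonneg (Finset.Ico_subset_Ico_right hge)
          fun i _ _ => add_nonneg (hd i) (he i)
    _ = dyadicBlockSum (fun i => d i - e i) k q
          + 2 * ∑ i ∈ Finset.Ico (q * 2 ^ k) ((q + 1) * 2 ^ k), e i := by
        rw [dyadicBlockSum, Finset.mul_sum, ← Finset.sum_add_distrib]
        exact Finset.sum_congr rfl fun i _ => by ring
    _ ≤ _ := by gcongr

/-- Dyadic chaining with a truncation level depending on the scale. -/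
lemma abs_sum_range_le_chaining {v m : ℕ → ℕ → ℝ} {ε : ℕ → ℝ}
    (hv : ∀ k i, v k i ≤ v (k + 1) i) (hm : ∀ k i, m k i ≤ m (k + 1) i)
    (hε : ∀ k i, m (k + 1) i - m k i ≤ ε k) {n j : ℕ} (hj : j < 2 ^ n) :
    |∑ i ∈ Finset.range j, (v n i - m n i)| ≤
      ∑ k ∈ Finset.range n, (√(dyadicSquareSum (fun i => v k i - m k i) n k)
        + √(dyadicSquareSum (fun i => (v (k + 1) i - v k i) - (m (k + 1) i - m k i)) n (k + 1))
        + 2 * (2 ^ (k + 1) * ε k)) := by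
  have h := sum_range_eq_sum_chain (fun k i => v k i - m k i) j n
  simp only [Nat.div_eq_of_lt hj, zero_mul, Finset.range_zero, Finset.sum_empty, sub_zero] at h
  rw [h]
  refine (Finset.abs_sum_le_sum_abs _ _).trans (Finset.sum_le_sum fun k hk => ?_)
  have hk := Finset.mem_range.1 hk
  refine (abs_add_le _ _).trans ?_
  rw [add_assoc]
  refine add_le_add (abs_sum_range_sub_le_sqrt _ hj hk) ?_
  have := abs_sum_Ico_sub_le (d := fun i => v (k + 1) i - v k i)
    (e := fun i => m (k + 1) i - m k i) (fun i => sub_nonneg.2 (hv k i))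
    (fun i => sub_nonneg.2 (hm k i)) (hε k) hj (Nat.succ_le_of_lt hk)
  refine le_trans (le_of_eq ?_) this
  rw [← Finset.sum_sub_distrib, ← Finset.sum_sub_distrib]
  congr 2 <;> exact Finset.sum_congr rfl fun i _ => by ring

/-- Cauchy–Schwarz with geometric weights. -/
lemma sum_range_sqrt_add_sqrt_le {r : ℝ} (hr0 : 0 < r) (hr : r < 1) {a b : ℕ → ℝ}
    (ha : ∀ k, 0 ≤ a k) (hb : ∀ k, 0 ≤ b k) (n : ℕ) :
    ∑ k ∈ Finset.range n, (√(a k) + √(b k)) ≤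
      √(2 / (1 - r) * ∑ k ∈ Finset.range n, (a k + b k) / r ^ (n - k)) := by
  have hr' : 0 < 1 - r := by linarith
  refine Real.le_sqrt_of_sq_le ?_
  -- The weights r^(n-k) decay away from the top scale n, so their sum is bounded independently of
  -- n.
  have hcs := Finset.sum_sq_le_sum_mul_sum_of_sq_le_mul (Finset.range n)
    (r := fun k => √(a k) + √(b k)) (f := fun k => r ^ (n - k))
    (g := fun k => (√(a k) + √(b k)) ^ 2 / r ^ (n - k)) (fun k _ => by positivity)
    (fun k _ => by positivity) (fun k _ => (by field_simp; rfl))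
  have hgeo : ∑ k ∈ Finset.range n, r ^ (n - k) ≤ 1 / (1 - r) := by
    calc ∑ k ∈ Finset.range n, r ^ (n - k) = ∑ k ∈ Finset.range n, r ^ (k + 1) := by
          rw [← Finset.sum_range_reflect]
          refine Finset.sum_congr rfl fun k hk => ?_
          have := Finset.mem_range.1 hk
          congr 1
          omega
      _ ≤ ∑ k ∈ Finset.range n, r ^ k :=
          Finset.sum_le_sum fun k _ => pow_le_pow_of_le_one hr0.le hr.le (Nat.le_succ k)
      _ ≤ ∑' k, r ^ k :=
          (summable_geometric_of_lt_one hr0.le hr).sum_le_tsum _ fun _ _ => by positivity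
      _ = 1 / (1 - r) := by rw [tsum_geometric_of_lt_one hr0.le hr, one_div]
  refine hcs.trans ?_
  calc _ ≤ 1 / (1 - r) * ∑ k ∈ Finset.range n, 2 * (a k + b k) / r ^ (n - k) := by
        refine mul_le_mul hgeo (Finset.sum_le_sum fun k _ => ?_)
          (Finset.sum_nonneg fun k _ => by positivity) (by positivity)
        gcongr
        have := add_sq_le (a := √(a k)) (b := √(b k))
        rwa [Real.sq_sqrt (ha k), Real.sq_sqrt (hb k)] at this
    _ = _ := by
        simp only [mul_div_assoc]
        rw [← Finset.mul_sum]
        ring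

/-! ### Covariance and moment bounds from tail inequalities -/

section probability

variable {Ω : Type*} [MeasurableSpace Ω] {μ : Measure Ω}

/-- Hoeffding's formula as an inequality: the layer-cake representation is applied to U under the
measure with density V, then to V on each set {s < U}, which reduces the claim to joint tails. -/
lemma lintegral_mul_le_of_tail_nqd {U V : Ω → ℝ} (hU : Measurable U) (hV : Measurable V)
    (hU0 : ∀ ω, 0 ≤ U ω) (hV0 : ∀ ω, 0 ≤ V ω)
    (h : ∀ s t : ℝ, 0 < s → 0 < t →
      μ {ω | s < U ω ∧ t < V ω} ≤ μ {ω | s < U ω} * μ {ω | t < V ω}) :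
    ∫⁻ ω, ENNReal.ofReal (U ω) * ENNReal.ofReal (V ω) ∂μ
      ≤ (∫⁻ ω, ENNReal.ofReal (U ω) ∂μ) * ∫⁻ ω, ENNReal.ofReal (V ω) ∂μ := by
  have hmU (s : ℝ) : MeasurableSet {ω | s < U ω} := measurableSet_lt measurable_const hU
  have hmV (s : ℝ) : MeasurableSet {ω | s < V ω} := measurableSet_lt measurable_const hV
  have hslice : ∀ s ∈ Set.Ioi (0 : ℝ),
      μ.withDensity (fun ω => ENNReal.ofReal (V ω)) {ω | s < U ω}
        ≤ μ {ω | s < U ω} * ∫⁻ ω, ENNReal.ofReal (V ω) ∂μ := by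
    intro s hs
    have hanti : Antitone fun t : ℝ => μ {ω | t < V ω} :=
      fun a b hab => measure_mono fun ω (hω : b < V ω) => hab.trans_lt hω
    rw [withDensity_apply _ (hmU s),
      lintegral_eq_lintegral_meas_lt _ (Eventually.of_forall hV0) hV.aemeasurable,
      lintegral_eq_lintegral_meas_lt _ (Eventually.of_forall hV0) hV.aemeasurable,
      ← lintegral_const_mul _ hanti.measurable]
    refine setLIntegral_mono' measurableSet_Ioi fun t ht => ?_
    rw [Measure.restrict_apply (hmV t), Set.inter_comm]
    exact h s t hs ht
  calc ∫⁻ ω, ENNReal.ofReal (U ω) * ENNReal.ofReal (V ω) ∂μ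
      = ∫⁻ ω, ENNReal.ofReal (U ω) ∂(μ.withDensity fun ω => ENNReal.ofReal (V ω)) := by
        rw [lintegral_withDensity_eq_lintegral_mul _ hV.ennreal_ofReal hU.ennreal_ofReal]
        simp only [Pi.mul_apply, mul_comm]
    _ = ∫⁻ s in Set.Ioi 0, μ.withDensity (fun ω => ENNReal.ofReal (V ω)) {ω | s < U ω} :=
        lintegral_eq_lintegral_meas_lt _ (Eventually.of_forall hU0) hU.aemeasurable
    _ ≤ ∫⁻ s in Set.Ioi 0, μ {ω | s < U ω} * ∫⁻ ω, ENNReal.ofReal (V ω) ∂μ :=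
        setLIntegral_mono' measurableSet_Ioi hslice
    _ = _ := by
        have hanti : Antitone fun s : ℝ => μ {ω | s < U ω} :=
          fun a b hab => measure_mono fun ω (hω : b < U ω) => hab.trans_lt hω
        rw [lintegral_mul_const _ hanti.measurable,
          ← lintegral_eq_lintegral_meas_lt _ (Eventually.of_forall hU0) hU.aemeasurable]

open ProbabilityTheory in
lemma covariance_nonpos_of_tail_nqd [IsProbabilityMeasure μ] {U V : Ω → ℝ} (hU : Measurable U)
    (hV : Measurable V) (hU0 : ∀ ω, 0 ≤ U ω) (hV0 : ∀ ω, 0 ≤ V ω)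
    (hU2 : MemLp U 2 μ) (hV2 : MemLp V 2 μ)
    (h : ∀ s t : ℝ, 0 < s → 0 < t →
      μ {ω | s < U ω ∧ t < V ω} ≤ μ {ω | s < U ω} * μ {ω | t < V ω}) :
    cov[U, V; μ] ≤ 0 := by
  rw [covariance_eq_sub hU2 hV2, sub_nonpos]
  have hUi := hU2.integrable one_le_two
  have hVi := hV2.integrable one_le_two
  rw [← ENNReal.ofReal_le_ofReal_iff
      (mul_nonneg (integral_nonneg hU0) (integral_nonneg hV0)),
    ENNReal.ofReal_mul (integral_nonneg hU0),
    ofReal_integral_eq_lintegral_ofReal hUi (Eventually.of_forall hU0),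
    ofReal_integral_eq_lintegral_ofReal hVi (Eventually.of_forall hV0),
    ofReal_integral_eq_lintegral_ofReal (hU2.integrable_mul hV2)
      (Eventually.of_forall fun ω => mul_nonneg (hU0 ω) (hV0 ω))]
  refine le_trans (le_of_eq ?_) (lintegral_mul_le_of_tail_nqd hU hV hU0 hV0 h)
  exact lintegral_congr fun ω => ENNReal.ofReal_mul (hU0 ω)

/-- Domination of tails passes to integrals of functions whose superlevel sets on `[0, ∞)` are
half-lines. -/
lemma integrable_and_integral_le_of_tail_le {U Y : Ω → ℝ} (hU : Measurable U) (hY : Measurable Y)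
    (hU0 : ∀ ω, 0 ≤ U ω) (hY0 : ∀ ω, 0 ≤ Y ω) {C : ℝ} (hC : 0 ≤ C)
    (h : ∀ t : ℝ, 0 < t → μ {ω | t < U ω} ≤ ENNReal.ofReal C * μ {ω | t < Y ω})
    {φ : ℝ → ℝ} (hφm : Measurable φ) (hφ0 : ∀ x, 0 ≤ φ x)
    (hφ : ∀ t : ℝ, 0 < t → (∃ s : ℝ, 0 < s ∧ ∀ x, 0 ≤ x → (t < φ x ↔ s < x)) ∨
      ∀ x, 0 ≤ x → φ x ≤ t) (hYi : Integrable (fun ω => φ (Y ω)) μ) :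
    Integrable (fun ω => φ (U ω)) μ ∧ ∫ ω, φ (U ω) ∂μ ≤ C * ∫ ω, φ (Y ω) ∂μ := by
  have hφU : Measurable fun ω => φ (U ω) := hφm.comp hU
  have hφY : Measurable fun ω => φ (Y ω) := hφm.comp hY
  have key : ∫⁻ ω, ENNReal.ofReal (φ (U ω)) ∂μ
      ≤ ENNReal.ofReal C * ∫⁻ ω, ENNReal.ofReal (φ (Y ω)) ∂μ := by
    rw [lintegral_eq_lintegral_meas_lt _ (Eventually.of_forall fun ω => hφ0 _) hφU.aemeasurable,
      lintegral_eq_lintegral_meas_lt _ (Eventually.of_forall fun ω => hφ0 _) hφY.aemeasurable,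
      ← lintegral_const_mul' _ _ ENNReal.ofReal_ne_top]
    -- At each level t the set {φ > t} is either a half-line, where the tail hypothesis applies, or
    -- empty.
    refine setLIntegral_mono' measurableSet_Ioi fun t ht => ?_
    rcases hφ t ht with ⟨s, hs, hst⟩ | hle
    · simp only [hst _ (hU0 _), hst _ (hY0 _)]
      exact h s hs
    · simp [(hle _ (hU0 _)).not_gt]
  rw [← ofReal_integral_eq_lintegral_ofReal hYi (Eventually.of_forall fun ω => hφ0 _),
    ← ENNReal.ofReal_mul hC] at key
  have hUi : Integrable (fun ω => φ (U ω)) μ := by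
    refine ⟨hφU.aestronglyMeasurable, ?_⟩
    rw [hasFiniteIntegral_iff_ofReal (Eventually.of_forall fun ω => hφ0 _)]
    exact key.trans_lt ENNReal.ofReal_lt_top
  refine ⟨hUi, ?_⟩
  rwa [← ofReal_integral_eq_lintegral_ofReal hUi (Eventually.of_forall fun ω => hφ0 _),
    ENNReal.ofReal_le_ofReal_iff (mul_nonneg hC (integral_nonneg fun ω => hφ0 _))] at key

-- Dropping the nonpositive off-diagonal covariances bounds the variance of a block by 2^k g. There
-- are 2^(n-k) blocks, so the total does not depend on the scale k.
open ProbabilityTheory in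
lemma integrable_and_integral_dyadicSquareSum_le [IsProbabilityMeasure μ] {W : ℕ → Ω → ℝ}
    (hW2 : ∀ i, MemLp (W i) 2 μ)
    (hcov : ∀ i j, i ≠ j → cov[W i, W j; μ] ≤ 0) {g : ℝ}
    (hg : ∀ i, ∫ ω, W i ω ^ 2 ∂μ ≤ g) {n k : ℕ} (hk : k ≤ n) :
    Integrable (fun ω => dyadicSquareSum (fun i => W i ω - ∫ ω', W i ω' ∂μ) n k) μ ∧
      ∫ ω, dyadicSquareSum (fun i => W i ω - ∫ ω', W i ω' ∂μ) n k ∂μ ≤ 2 ^ n * g := by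
  have hblock (m : ℕ) : MemLp
      (fun ω => dyadicBlockSum (fun i => W i ω - ∫ ω', W i ω' ∂μ) k m) 2 μ := by
    unfold dyadicBlockSum
    exact memLp_finsetSum _ fun i _ => (hW2 i).sub (memLp_const _)
  have hint (m : ℕ) := (hblock m).integrable_sq
  have hvar (m : ℕ) :
      ∫ ω, dyadicBlockSum (fun i => W i ω - ∫ ω', W i ω' ∂μ) k m ^ 2 ∂μ ≤ 2 ^ k * g := by
    set s := Finset.Ico (m * 2 ^ k) ((m + 1) * 2 ^ k) with hs
    have hcard : s.card = 2 ^ k := by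
      rw [hs, Nat.card_Ico, ← Nat.sub_mul, Nat.add_sub_cancel_left, one_mul]
    have hsum : MemLp (fun ω => ∑ i ∈ s, W i ω) 2 μ := memLp_finsetSum _ fun i _ => hW2 i
    have heq : ∫ ω, dyadicBlockSum (fun i => W i ω - ∫ ω', W i ω' ∂μ) k m ^ 2 ∂μ
        = Var[fun ω => ∑ i ∈ s, W i ω; μ] := by
      rw [variance_eq_integral hsum.aemeasurable,
        integral_finsetSum _ fun i _ => (hW2 i).integrable one_le_two]
      simp only [dyadicBlockSum, Finset.sum_sub_distrib, hs]
    rw [heq, variance_fun_sum' fun i _ => hW2 i]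
    calc ∑ i ∈ s, ∑ j ∈ s, cov[W i, W j; μ] ≤ ∑ i ∈ s, g := by
          refine Finset.sum_le_sum fun i hi => ?_
          calc ∑ j ∈ s, cov[W i, W j; μ] ≤ ∑ j ∈ s, if i = j then cov[W i, W j; μ] else 0 := by
                refine Finset.sum_le_sum fun j _ => ?_
                split_ifs with hij
                · exact le_rfl
                · exact hcov i j hij
            _ = cov[W i, W i; μ] := by rw [Finset.sum_ite_eq, if_pos hi]
            _ = Var[W i; μ] := covariance_self (hW2 i).aemeasurable
            _ ≤ ∫ ω, (W i ^ 2) ω ∂μ := variance_le_expectation_sq (hW2 i).aestronglyMeasurable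
            _ ≤ g := hg i
      _ = 2 ^ k * g := by rw [Finset.sum_const, hcard, nsmul_eq_mul]; push_cast; rfl
  refine ⟨integrable_finsetSum _ fun m _ => hint m, ?_⟩
  unfold dyadicSquareSum
  rw [integral_finsetSum _ fun m _ => hint m]
  refine (Finset.sum_le_sum fun m _ => hvar m).trans (le_of_eq ?_)
  rw [Finset.sum_const, Finset.card_range, nsmul_eq_mul, ← mul_assoc]
  push_cast
  rw [← pow_add, Nat.sub_add_cancel hk]

/-- Nonnegative random variables with summable means converge to `0` almost surely. -/
lemma ae_tendsto_zero_of_summable_integral {f : ℕ → Ω → ℝ} (hf0 : ∀ n ω, 0 ≤ f n ω)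
    (hf : ∀ n, Integrable (f n) μ) (hs : Summable fun n => ∫ ω, f n ω ∂μ) :
    ∀ᵐ ω ∂μ, Tendsto (fun n => f n ω) atTop (𝓝 0) := by
  have hlt : ∫⁻ ω, ∑' n, ENNReal.ofReal (f n ω) ∂μ ≠ ⊤ := by
    rw [lintegral_tsum fun n => (hf n).aemeasurable.ennreal_ofReal]
    simp only [← ofReal_integral_eq_lintegral_ofReal (hf _) (Eventually.of_forall (hf0 _))]
    rw [← ENNReal.ofReal_tsum_of_nonneg (fun n => integral_nonneg (hf0 n)) hs]
    exact ENNReal.ofReal_ne_top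
  filter_upwards [ae_lt_top' (AEMeasurable.tsum
    fun n => (hf n).aemeasurable.ennreal_ofReal) hlt] with ω hω
  have h := ENNReal.tendsto_atTop_zero_of_tsum_ne_top hω.ne
  have h2 := (ENNReal.tendsto_toReal ENNReal.zero_ne_top).comp h
  simpa [Function.comp_def, ENNReal.toReal_ofReal (hf0 _ ω)] using h2

end probability

/-! ### Truncation of nonnegative variables -/

section nonneg

variable {Ω : Type*} [MeasurableSpace Ω] {μ : Measure Ω} {p : ℝ}

lemma integrable_of_integrable_rpow [IsFiniteMeasure μ] (hp1 : 1 < p) {Y : Ω → ℝ}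
    (hY : Measurable Y) (hY0 : ∀ ω, 0 ≤ Y ω) (hYp : Integrable (fun ω => Y ω ^ p) μ) :
    Integrable Y μ := by
  refine ((integrable_const (1 : ℝ)).add hYp).mono' hY.aestronglyMeasurable
    (Eventually.of_forall fun ω => ?_)
  rw [Real.norm_of_nonneg (hY0 ω)]
  rcases le_or_gt (Y ω) 1 with h | h
  · have := Real.rpow_nonneg (hY0 ω) p
    simp only [Pi.add_apply]
    linarith
  · have := Real.rpow_le_rpow_of_exponent_le h.le hp1.le
    rw [Real.rpow_one] at this
    simp only [Pi.add_apply]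
    linarith

lemma memLp_min_const [IsFiniteMeasure μ] {U : Ω → ℝ} (hU : Measurable U) (hU0 : ∀ ω, 0 ≤ U ω)
    {b : ℝ} (hb : 0 ≤ b) : MemLp (fun ω => min (U ω) b) 2 μ := by
  refine MemLp.of_bound (hU.min measurable_const).aestronglyMeasurable b
    (Eventually.of_forall fun ω => ?_)
  rw [Real.norm_of_nonneg (le_min (hU0 ω) hb)]
  exact min_le_right _ _

lemma summable_integral_of_sum_le {f : ℕ → Ω → ℝ} {h : Ω → ℝ} (hf0 : ∀ k ω, 0 ≤ f k ω)
    (hf : ∀ k, Integrable (f k) μ) (hh : Integrable h μ)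
    (hle : ∀ N ω, ∑ k ∈ Finset.range N, f k ω ≤ h ω) : Summable fun k => ∫ ω, f k ω ∂μ := by
  refine summable_of_sum_range_le (c := ∫ ω, h ω ∂μ) (fun k => integral_nonneg (hf0 k))
    fun N => ?_
  rw [← integral_finsetSum _ fun k _ => hf k]
  exact integral_mono (integrable_finsetSum _ fun k _ => hf k) hh (hle N)

lemma summable_integral_min_sq [IsFiniteMeasure μ] (hp1 : 1 < p) (hp2 : p < 2) {Y : Ω → ℝ}
    (hY : Measurable Y) (hY0 : ∀ ω, 0 ≤ Y ω) (hYp : Integrable (fun ω => Y ω ^ p) μ) :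
    Summable fun k : ℕ => (2 / ((2 : ℝ) ^ (1 / p)) ^ 2) ^ k *
      ∫ ω, min (Y ω) ((2 ^ (1 / p)) ^ k) ^ 2 ∂μ := by
  obtain ⟨c, hc⟩ := sum_range_mul_min_sq_le hp1 hp2
  simp only [← integral_const_mul]
  exact summable_integral_of_sum_le (fun k ω => by positivity)
    (fun k => (memLp_min_const hY hY0 (by positivity)).integrable_sq.const_mul _)
    (hYp.const_mul c) (fun N ω => hc _ (hY0 ω) N)

lemma integrable_posPart_sub [IsFiniteMeasure μ] {Y : Ω → ℝ} (hY : Integrable Y μ) (b : ℝ) :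
    Integrable (fun ω => max (Y ω - b) 0) μ :=
  (hY.sub (integrable_const b)).pos_part

lemma summable_integral_posPart_sub [IsFiniteMeasure μ] (hp1 : 1 < p) {Y : Ω → ℝ}
    (hY : Measurable Y) (hY0 : ∀ ω, 0 ≤ Y ω) (hYp : Integrable (fun ω => Y ω ^ p) μ) :
    Summable fun k : ℕ => (2 / (2 : ℝ) ^ (1 / p)) ^ k *
      ∫ ω, max (Y ω - (2 ^ (1 / p)) ^ k) 0 ∂μ := by
  obtain ⟨c, hc⟩ := sum_range_mul_posPart_sub_le hp1
  have hYi := integrable_of_integrable_rpow hp1 hY hY0 hYp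
  simp only [← integral_const_mul]
  exact summable_integral_of_sum_le
    (fun k ω => mul_nonneg (by positivity) (le_max_right _ _))
    (fun k => (integrable_posPart_sub hYi _).const_mul _)
    (hYp.const_mul c) (fun N ω => hc _ (hY0 ω) N)

section tail

variable {U Y : Ω → ℝ} {C : ℝ}

lemma integral_min_sq_le_of_tail_le [IsFiniteMeasure μ] (hU : Measurable U) (hY : Measurable Y)
    (hU0 : ∀ ω, 0 ≤ U ω) (hY0 : ∀ ω, 0 ≤ Y ω) (hC : 0 ≤ C)
    (h : ∀ t : ℝ, 0 < t → μ {ω | t < U ω} ≤ ENNReal.ofReal C * μ {ω | t < Y ω})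
    {b : ℝ} (hb : 0 ≤ b) :
    ∫ ω, min (U ω) b ^ 2 ∂μ ≤ C * ∫ ω, min (Y ω) b ^ 2 ∂μ := by
  refine (integrable_and_integral_le_of_tail_le hU hY hU0 hY0 hC h
    (φ := fun x => min x b ^ 2) (by fun_prop) (fun x => sq_nonneg _) (fun t ht => ?_)
    (memLp_min_const hY hY0 hb).integrable_sq).2
  rcases lt_or_ge (√t) b with htb | htb
  · refine Or.inl ⟨√t, Real.sqrt_pos.2 ht, fun x hx => ?_⟩
    have h2 := pow_lt_pow_iff_left₀ (Real.sqrt_nonneg t) (le_min hx hb) two_ne_zero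
    rw [Real.sq_sqrt ht.le] at h2
    rw [h2, lt_min_iff, and_iff_left htb]
  · refine Or.inr fun x hx => ?_
    have h1 : min x b ≤ √t := (min_le_right _ _).trans htb
    calc min x b ^ 2 ≤ √t ^ 2 := pow_le_pow_left₀ (le_min hx hb) h1 2
      _ = t := Real.sq_sqrt ht.le

lemma integral_posPart_sub_le_of_tail_le [IsFiniteMeasure μ] (hU : Measurable U)
    (hY : Measurable Y) (hU0 : ∀ ω, 0 ≤ U ω) (hY0 : ∀ ω, 0 ≤ Y ω) (hC : 0 ≤ C)
    (h : ∀ t : ℝ, 0 < t → μ {ω | t < U ω} ≤ ENNReal.ofReal C * μ {ω | t < Y ω})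
    (hYi : Integrable Y μ) {b : ℝ} (hb : 0 ≤ b) :
    ∫ ω, max (U ω - b) 0 ∂μ ≤ C * ∫ ω, max (Y ω - b) 0 ∂μ := by
  refine (integrable_and_integral_le_of_tail_le hU hY hU0 hY0 hC h
    (φ := fun x => max (x - b) 0) (by fun_prop) (fun x => le_max_right _ _) (fun t ht => ?_)
    (integrable_posPart_sub hYi b)).2
  refine Or.inl ⟨t + b, by linarith, fun x _ => ?_⟩
  rw [lt_max_iff]
  constructor
  · rintro (h | h) <;> linarith
  · intro h
    left
    linarith

lemma integrable_of_tail_le (hU : Measurable U)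
    (hY : Measurable Y) (hU0 : ∀ ω, 0 ≤ U ω) (hY0 : ∀ ω, 0 ≤ Y ω) (hC : 0 ≤ C)
    (h : ∀ t : ℝ, 0 < t → μ {ω | t < U ω} ≤ ENNReal.ofReal C * μ {ω | t < Y ω})
    (hYi : Integrable Y μ) : Integrable U μ := by
  have hmax (Z : Ω → ℝ) (hZ : ∀ ω, 0 ≤ Z ω) : (fun ω => max (Z ω) 0) = Z :=
    funext fun ω => max_eq_left (hZ ω)
  have := (integrable_and_integral_le_of_tail_le hU hY hU0 hY0 hC h
    (φ := fun x => max x 0) (by fun_prop) (fun x => le_max_right _ _)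
    (fun t ht => Or.inl ⟨t, ht, fun x hx => by rw [max_eq_left hx]⟩)
    (by rwa [hmax Y hY0])).1
  rwa [hmax U hU0] at this

end tail

-- A layer of U exceeds s > 0 exactly when U exceeds s + a and s + a < b. Its superlevel sets are
-- therefore superlevel sets of U or empty, and the tail inequality carries over.
open ProbabilityTheory in
lemma covariance_min_sub_min_nonpos [IsProbabilityMeasure μ] {U V : Ω → ℝ} (hU : Measurable U)
    (hV : Measurable V) (hU0 : ∀ ω, 0 ≤ U ω) (hV0 : ∀ ω, 0 ≤ V ω)
    (h : ∀ s t : ℝ, 0 < s → 0 < t →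
      μ {ω | s < U ω ∧ t < V ω} ≤ μ {ω | s < U ω} * μ {ω | t < V ω})
    {a b : ℝ} (ha : 0 ≤ a) (hab : a ≤ b) :
    cov[fun ω => min (U ω) b - min (U ω) a, fun ω => min (V ω) b - min (V ω) a; μ] ≤ 0 := by
  have hset (x s : ℝ) (hs : 0 < s) : s < min x b - min x a ↔ s + a < x ∧ s + a < b := by
    rcases le_total x a with h1 | h1
    · rw [min_eq_left h1, min_eq_left (h1.trans hab), sub_self]
      constructor
      · intro h; linarith
      · rintro ⟨h, -⟩; linarith
    · rw [min_eq_right h1, lt_sub_iff_add_lt, lt_min_iff]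
  refine covariance_nonpos_of_tail_nqd ((hU.min measurable_const).sub (hU.min measurable_const))
    ((hV.min measurable_const).sub (hV.min measurable_const))
    (fun ω => sub_nonneg.2 (min_le_min_left _ hab)) (fun ω => sub_nonneg.2 (min_le_min_left _ hab))
    ((memLp_min_const hU hU0 (ha.trans hab)).sub (memLp_min_const hU hU0 ha))
    ((memLp_min_const hV hV0 (ha.trans hab)).sub (memLp_min_const hV hV0 ha))
    fun s t hs ht => ?_
  simp only [hset _ s hs, hset _ t ht]
  by_cases hsb : s + a < b
  · by_cases htb : t + a < b
    · simp only [hsb, htb, and_true]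
      exact h _ _ (by linarith) (by linarith)
    · simp [htb]
  · simp [hsb]

open ProbabilityTheory in
lemma covariance_min_nonpos [IsProbabilityMeasure μ] {U V : Ω → ℝ} (hU : Measurable U)
    (hV : Measurable V) (hU0 : ∀ ω, 0 ≤ U ω) (hV0 : ∀ ω, 0 ≤ V ω)
    (h : ∀ s t : ℝ, 0 < s → 0 < t →
      μ {ω | s < U ω ∧ t < V ω} ≤ μ {ω | s < U ω} * μ {ω | t < V ω})
    {b : ℝ} (hb : 0 ≤ b) :
    cov[fun ω => min (U ω) b, fun ω => min (V ω) b; μ] ≤ 0 := by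
  have := covariance_min_sub_min_nonpos hU hV hU0 hV0 h le_rfl hb
  simpa only [min_eq_right (hU0 _), min_eq_right (hV0 _), sub_zero] using this

/-- Where no V_i exceeds b, truncation changes only the centring, by the mean excess over b for each
index. -/
lemma abs_sum_range_sub_integral_le [IsProbabilityMeasure μ] {V : ℕ → Ω → ℝ}
    (hVi : ∀ i, Integrable (V i) μ) {b ε : ℝ}
    (hε : ∀ i, ∫ ω, max (V i ω - b) 0 ∂μ ≤ ε) {ω : Ω} {N j : ℕ} (hj : j ≤ N)
    (hω : ∀ i < N, V i ω ≤ b) :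
    |∑ i ∈ Finset.range j, (V i ω - ∫ ω', V i ω' ∂μ)| ≤
      |∑ i ∈ Finset.range j, (min (V i ω) b - ∫ ω', min (V i ω') b ∂μ)| + N * ε := by
  have hε0 : 0 ≤ ε := (integral_nonneg fun ω => le_max_right _ _).trans (hε 0)
  have hdecomp (i : ℕ) : ∫ ω, V i ω ∂μ = ∫ ω, min (V i ω) b ∂μ + ∫ ω, max (V i ω - b) 0 ∂μ := by
    have hmin : Integrable (fun ω => min (V i ω) b) μ := (hVi i).inf (integrable_const b)
    rw [← integral_add hmin (integrable_posPart_sub (hVi i) b)]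
    refine integral_congr_ae (Eventually.of_forall fun ω => ?_)
    rcases le_total (V i ω) b with h | h
    · simp [h]
    · simp [h]
  have heq : ∑ i ∈ Finset.range j, (V i ω - ∫ ω', V i ω' ∂μ)
      = ∑ i ∈ Finset.range j, (min (V i ω) b - ∫ ω', min (V i ω') b ∂μ)
        - ∑ i ∈ Finset.range j, ∫ ω', max (V i ω' - b) 0 ∂μ := by
    rw [← Finset.sum_sub_distrib]
    refine Finset.sum_congr rfl fun i hi => ?_
    rw [hdecomp, min_eq_left (hω i ((Finset.mem_range.1 hi).trans_le hj))]
    ring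
  rw [heq]
  refine (abs_sub _ _).trans (add_le_add le_rfl ?_)
  rw [abs_of_nonneg (Finset.sum_nonneg fun i _ => integral_nonneg fun ω => le_max_right _ _)]
  refine (Finset.sum_le_card_nsmul _ _ ε fun i _ => hε i).trans ?_
  rw [Finset.card_range, nsmul_eq_mul]
  gcongr

end nonneg

/-! ### The strong law for nonnegative variables -/

section strongLaw

variable {Ω : Type*} [MeasurableSpace Ω] {μ : Measure Ω}

/-- This plays the role of Borel–Cantelli: a single i < 2^n with V_i > β^n would make the quotient
at least 1, so eventually truncation at β^n is inactive on the whole range. -/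
lemma ae_tendsto_sum_min_sq [IsProbabilityMeasure μ] {V : ℕ → Ω → ℝ} {β : ℝ} {g : ℕ → ℝ}
    (hV : ∀ i, Measurable (V i)) (hV0 : ∀ i ω, 0 ≤ V i ω) (hβ : 0 < β)
    (hg : ∀ k i, ∫ ω, min (V i ω) (β ^ k) ^ 2 ∂μ ≤ g k)
    (hgs : Summable fun k => (2 / β ^ 2) ^ k * g k) :
    ∀ᵐ ω ∂μ, Tendsto
      (fun n => (∑ i ∈ Finset.range (2 ^ n), min (V i ω) (β ^ n) ^ 2) / (β ^ 2) ^ n)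
      atTop (𝓝 0) := by
  have hi (n i : ℕ) : Integrable (fun ω => min (V i ω) (β ^ n) ^ 2) μ :=
    (memLp_min_const (hV i) (hV0 i) (by positivity)).integrable_sq
  refine ae_tendsto_zero_of_summable_integral (fun n ω => by positivity)
    (fun n => (integrable_finsetSum _ fun i _ => hi n i).div_const _) ?_
  refine Summable.of_nonneg_of_le (fun n => integral_nonneg fun ω => by positivity)
    (fun n => ?_) hgs
  rw [integral_div, integral_finsetSum _ fun i _ => hi n i, div_le_iff₀ (by positivity)]
  refine (Finset.sum_le_card_nsmul _ _ (g n) fun i _ => hg n i).trans (le_of_eq ?_)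
  rw [Finset.card_range, nsmul_eq_mul, div_pow]
  push_cast
  field_simp

/-- The weighted sum of the square sums at all scales which controls the chaining bound. -/
noncomputable def chainingSquareSum (v m : ℕ → ℕ → ℝ) (q : ℝ) (n : ℕ) : ℝ :=
  ∑ k ∈ Finset.range n, (dyadicSquareSum (fun i => v k i - m k i) n k
    + dyadicSquareSum (fun i => (v (k + 1) i - v k i) - (m (k + 1) i - m k i)) n (k + 1))
      / q ^ (n - k)

lemma chainingSquareSum_nonneg (v m : ℕ → ℕ → ℝ) {q : ℝ} (hq : 0 ≤ q) (n : ℕ) :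
    0 ≤ chainingSquareSum v m q n :=
  Finset.sum_nonneg fun k _ => div_nonneg
    (add_nonneg (dyadicSquareSum_nonneg _ _ _) (dyadicSquareSum_nonneg _ _ _)) (by positivity)

/-- The normalised means are bounded by the convolution of r^k (g k + g (k + 1)) with (√r)^k, where
r = 2/β^2, hence are summable. -/
lemma ae_tendsto_chainingSquareSum [IsProbabilityMeasure μ] {V : ℕ → Ω → ℝ} {β : ℝ} {g : ℕ → ℝ}
    (hV : ∀ i, Measurable (V i)) (hV0 : ∀ i ω, 0 ≤ V i ω)
    (hneg : ∀ i j, i ≠ j → ∀ s t : ℝ, 0 < s → 0 < t →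
      μ {ω | s < V i ω ∧ t < V j ω} ≤ μ {ω | s < V i ω} * μ {ω | t < V j ω})
    (hβ : 1 < β) (hβ2 : 2 < β ^ 2) (hg0 : ∀ k, 0 ≤ g k)
    (hg : ∀ k i, ∫ ω, min (V i ω) (β ^ k) ^ 2 ∂μ ≤ g k)
    (hgs : Summable fun k => (2 / β ^ 2) ^ k * g k) :
    ∀ᵐ ω ∂μ, Tendsto
      (fun n => chainingSquareSum (fun k i => min (V i ω) (β ^ k))
        (fun k i => ∫ ω', min (V i ω') (β ^ k) ∂μ) (√(2 / β ^ 2)) n / (β ^ 2) ^ n)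
      atTop (𝓝 0) := by
  have hβ0 : 0 < β := by linarith
  set r := 2 / β ^ 2 with hr
  have hr0 : 0 < r := by positivity
  have hr1 : r < 1 := by rw [hr, div_lt_one (by positivity)]; exact hβ2
  have hq0 : 0 < √r := Real.sqrt_pos.2 hr0
  have hq1 : √r < 1 := by rw [Real.sqrt_lt' one_pos]; simpa using hr1
  have hL (k i : ℕ) : MemLp (fun ω => min (V i ω) (β ^ k)) 2 μ :=
    memLp_min_const (hV i) (hV0 i) (by positivity)
  have hLi (k i : ℕ) : Integrable (fun ω => min (V i ω) (β ^ k)) μ :=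
    (hL k i).integrable one_le_two
  have hpow (k : ℕ) : β ^ k ≤ β ^ (k + 1) := pow_le_pow_right₀ hβ.le (Nat.le_succ k)
  have hA {n k : ℕ} (hk : k ≤ n) := integrable_and_integral_dyadicSquareSum_le
    (fun i => hL k i) (fun i j hij => covariance_min_nonpos (hV i) (hV j) (hV0 i) (hV0 j)
      (hneg i j hij) (pow_nonneg hβ0.le k)) (hg k) hk
  have hgd (k i : ℕ) : ∫ ω, (min (V i ω) (β ^ (k + 1)) - min (V i ω) (β ^ k)) ^ 2 ∂μ
      ≤ g (k + 1) := by
    refine (integral_mono ((hL (k + 1) i).sub (hL k i)).integrable_sq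
      (hL (k + 1) i).integrable_sq fun ω => ?_).trans (hg (k + 1) i)
    have h1 : min (V i ω) (β ^ k) ≤ min (V i ω) (β ^ (k + 1)) := min_le_min_left _ (hpow k)
    have h2 : 0 ≤ min (V i ω) (β ^ k) := le_min (hV0 i ω) (by positivity)
    exact pow_le_pow_left₀ (sub_nonneg.2 h1) (sub_le_self _ h2) 2
  have hB {n k : ℕ} (hk : k + 1 ≤ n) :
      Integrable (fun ω => dyadicSquareSum (fun i =>
        (min (V i ω) (β ^ (k + 1)) - min (V i ω) (β ^ k))
          - (∫ ω', min (V i ω') (β ^ (k + 1)) ∂μ - ∫ ω', min (V i ω') (β ^ k) ∂μ))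
            n (k + 1)) μ ∧
      ∫ ω, dyadicSquareSum (fun i => (min (V i ω) (β ^ (k + 1)) - min (V i ω) (β ^ k))
          - (∫ ω', min (V i ω') (β ^ (k + 1)) ∂μ - ∫ ω', min (V i ω') (β ^ k) ∂μ))
            n (k + 1) ∂μ ≤ 2 ^ n * g (k + 1) := by
    have := integrable_and_integral_dyadicSquareSum_le
      (W := fun i ω => min (V i ω) (β ^ (k + 1)) - min (V i ω) (β ^ k))
      (fun i => (hL (k + 1) i).sub (hL k i))
      (fun i j hij => covariance_min_sub_min_nonpos (hV i) (hV j) (hV0 i) (hV0 j)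
        (hneg i j hij) (pow_nonneg hβ0.le k) (hpow k)) (hgd k) hk
    simpa only [integral_sub (hLi _ _) (hLi _ _)] using this
  have hterm (n : ℕ) : ∀ k ∈ Finset.range n, Integrable (fun ω =>
      (dyadicSquareSum (fun i => min (V i ω) (β ^ k) - ∫ ω', min (V i ω') (β ^ k) ∂μ) n k
        + dyadicSquareSum (fun i => (min (V i ω) (β ^ (k + 1)) - min (V i ω) (β ^ k))
          - (∫ ω', min (V i ω') (β ^ (k + 1)) ∂μ - ∫ ω', min (V i ω') (β ^ k) ∂μ))
            n (k + 1)) / √r ^ (n - k)) μ := fun k hk =>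
    ((hA (Finset.mem_range.1 hk).le).1.add (hB (Finset.mem_range.1 hk)).1).div_const _
  refine ae_tendsto_zero_of_summable_integral
    (fun n ω => div_nonneg (chainingSquareSum_nonneg _ _ hq0.le _) (by positivity))
    (fun n => (integrable_finsetSum _ (hterm n)).div_const _) ?_
  have hshift : Summable fun k => r ^ k * g (k + 1) := by
    have := ((summable_nat_add_iff 1).2 hgs).mul_left r⁻¹
    refine this.congr fun k => ?_
    rw [pow_succ]
    field_simp
  have hconv := summable_sum_range_mul_sub (a := fun k => r ^ k * g k + r ^ k * g (k + 1))
    (b := fun k => √r ^ k)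
    (fun k => add_nonneg (mul_nonneg (by positivity) (hg0 _)) (mul_nonneg (by positivity) (hg0 _)))
    (fun k => by positivity) (hgs.add hshift) (summable_geometric_of_lt_one hq0.le hq1)
  refine Summable.of_nonneg_of_le (fun n => integral_nonneg fun ω =>
    div_nonneg (chainingSquareSum_nonneg _ _ hq0.le _) (by positivity)) (fun n => ?_) hconv
  unfold chainingSquareSum
  rw [integral_div, integral_finsetSum _ (hterm n), div_le_iff₀ (by positivity), Finset.sum_mul]
  refine Finset.sum_le_sum fun k hk => ?_
  have hk := Finset.mem_range.1 hk
  rw [integral_div, integral_add (hA hk.le).1 (hB hk).1, div_le_iff₀ (by positivity)]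
  refine (add_le_add (hA hk.le).2 (hB hk).2).trans (le_of_eq ?_)
  -- Half of the decay r^(n-k) pays for the Cauchy–Schwarz weight; the other half remains as
  -- convolution kernel.
  have h1 : √r ^ (n - k) * √r ^ (n - k) = r ^ (n - k) := by
    rw [← mul_pow, Real.mul_self_sqrt hr0.le]
  have h2 : r ^ k * r ^ (n - k) * (β ^ 2) ^ n = 2 ^ n := by
    rw [← pow_add, Nat.add_sub_cancel' hk.le, ← mul_pow, hr, div_mul_cancel₀ _ (by positivity)]
  rw [← h2, ← h1]
  ring

/-- The strong law for nonnegative variables, for partial sums shorter than `2 ^ n`. -/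
lemma ae_exists_bound_sum_range [IsProbabilityMeasure μ] {V : ℕ → Ω → ℝ} {β : ℝ}
    {g ε : ℕ → ℝ} (hV : ∀ i, Measurable (V i)) (hV0 : ∀ i ω, 0 ≤ V i ω)
    (hVi : ∀ i, Integrable (V i) μ)
    (hneg : ∀ i j, i ≠ j → ∀ s t : ℝ, 0 < s → 0 < t →
      μ {ω | s < V i ω ∧ t < V j ω} ≤ μ {ω | s < V i ω} * μ {ω | t < V j ω})
    (hβ : 1 < β) (hβ2 : 2 < β ^ 2)
    (hg : ∀ k i, ∫ ω, min (V i ω) (β ^ k) ^ 2 ∂μ ≤ g k)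
    (hgs : Summable fun k => (2 / β ^ 2) ^ k * g k)
    (hε : ∀ k i, ∫ ω, max (V i ω - β ^ k) 0 ∂μ ≤ ε k)
    (hεs : Summable fun k => (2 / β) ^ k * ε k) :
    ∀ᵐ ω ∂μ, ∃ R : ℕ → ℝ, Tendsto R atTop (𝓝 0) ∧ ∀ᶠ n in atTop, ∀ j < 2 ^ n,
      |∑ i ∈ Finset.range j, (V i ω - ∫ ω', V i ω' ∂μ)| ≤ β ^ n * R n := by
  have hβ0 : 0 < β := by linarith
  have hg0 (k : ℕ) : 0 ≤ g k := (integral_nonneg fun ω => sq_nonneg _).trans (hg k 0)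
  have hε0 (k : ℕ) : 0 ≤ ε k := (integral_nonneg fun ω => le_max_right _ _).trans (hε k 0)
  filter_upwards [ae_tendsto_sum_min_sq hV hV0 hβ0 hg hgs,
    ae_tendsto_chainingSquareSum hV hV0 hneg hβ hβ2 hg0 hg hgs] with ω hω1 hω2
  set r := 2 / β ^ 2 with hr
  have hr0 : 0 < r := by positivity
  have hr1 : r < 1 := by rw [hr, div_lt_one (by positivity)]; exact hβ2
  have hq0 : 0 < √r := Real.sqrt_pos.2 hr0
  have hq1 : √r < 1 := by rw [Real.sqrt_lt' one_pos]; simpa using hr1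
  set v : ℕ → ℕ → ℝ := fun k i => min (V i ω) (β ^ k) with hv
  set m : ℕ → ℕ → ℝ := fun k i => ∫ ω', min (V i ω') (β ^ k) ∂μ with hm
  have hpow (k : ℕ) : β ^ k ≤ β ^ (k + 1) := pow_le_pow_right₀ hβ.le (Nat.le_succ k)
  have hLi (k i : ℕ) : Integrable (fun ω => min (V i ω) (β ^ k)) μ :=
    (memLp_min_const (hV i) (hV0 i) (by positivity)).integrable one_le_two
  have hinc (k i : ℕ) : m (k + 1) i - m k i ≤ ε k := by
    rw [hm]
    dsimp only
    rw [← integral_sub (hLi _ _) (hLi _ _)]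
    refine (integral_mono ((hLi _ _).sub (hLi _ _)) (integrable_posPart_sub (hVi i) (β ^ k))
      fun ω => ?_).trans (hε k i)
    simp only [Pi.sub_apply]
    rcases le_total (V i ω) (β ^ k) with h | h
    · rw [min_eq_left h, min_eq_left (h.trans (hpow k)), sub_self]
      exact le_max_right _ _
    · rw [min_eq_right h]
      exact (sub_le_sub_right (min_le_left _ _) _).trans (le_max_left _ _)
  -- The accumulated means 2 · 2^(k+1) ε k divided by β^n. The spare factor β^(-(n-k)) makes this a
  -- convolution of summable sequences.
  set D : ℕ → ℝ := fun n => ∑ k ∈ Finset.range n, (4 * ((2 / β) ^ k * ε k)) * β⁻¹ ^ (n - k) with hD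
  have hDlim : Tendsto D atTop (𝓝 0) := by
    refine (summable_sum_range_mul_sub (fun k => ?_) (fun k => by positivity) (hεs.mul_left 4)
      (summable_geometric_of_lt_one (by positivity)
        (inv_lt_one_of_one_lt₀ hβ))).tendsto_atTop_zero
    have := hε0 k
    positivity
  refine ⟨fun n => √(2 / (1 - √r) * (chainingSquareSum v m (√r) n / (β ^ 2) ^ n)) + D n
    + (2 / β) ^ n * ε n, ?_, ?_⟩
  · have h1 := ((hω2.const_mul (2 / (1 - √r))).sqrt.add hDlim).add hεs.tendsto_atTop_zero
    simpa using h1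
  · filter_upwards [hω1.eventually_lt_const one_pos] with n hn j hj
    have hVle : ∀ i < 2 ^ n, V i ω ≤ β ^ n := by
      intro i hi
      by_contra! hlt
      rw [div_lt_one (by positivity)] at hn
      have := Finset.single_le_sum (f := fun i => min (V i ω) (β ^ n) ^ 2)
        (fun _ _ => sq_nonneg _) (Finset.mem_range.2 hi)
      rw [min_eq_right hlt.le, ← pow_mul, mul_comm n 2, pow_mul] at this
      linarith
    refine (abs_sum_range_sub_integral_le hVi (hε n) hj.le hVle).trans ?_
    have hchain := abs_sum_range_le_chaining (v := v) (m := m) (ε := ε)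
      (fun k i => min_le_min_left _ (hpow k))
      (fun k i => integral_mono (hLi _ _) (hLi _ _) fun ω => min_le_min_left _ (hpow k)) hinc hj
    rw [Finset.sum_add_distrib] at hchain
    have hsqrt := sum_range_sqrt_add_sqrt_le hq0 hq1
      (a := fun k => dyadicSquareSum (fun i => v k i - m k i) n k)
      (b := fun k => dyadicSquareSum
        (fun i => (v (k + 1) i - v k i) - (m (k + 1) i - m k i)) n (k + 1))
      (fun k => dyadicSquareSum_nonneg _ _ _) (fun k => dyadicSquareSum_nonneg _ _ _) n
    have e1 : √(2 / (1 - √r) * chainingSquareSum v m (√r) n)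
        = β ^ n * √(2 / (1 - √r) * (chainingSquareSum v m (√r) n / (β ^ 2) ^ n)) := by
      rw [← mul_div_assoc]
      generalize 2 / (1 - √r) * chainingSquareSum v m (√r) n = S
      rw [Real.sqrt_div' _ (by positivity), ← pow_mul, mul_comm 2 n, pow_mul,
        Real.sqrt_sq (by positivity)]
      field_simp
    have e2 : ∑ k ∈ Finset.range n, 2 * (2 ^ (k + 1) * ε k) = β ^ n * D n := by
      rw [hD, Finset.mul_sum]
      refine Finset.sum_congr rfl fun k hk => ?_
      have : β ^ n = β ^ k * β ^ (n - k) := by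
        rw [← pow_add, Nat.add_sub_cancel' (Finset.mem_range.1 hk).le]
      rw [this, div_pow, inv_pow, pow_succ]
      field_simp
      ring
    have e3 : ((2 ^ n : ℕ) : ℝ) * ε n = β ^ n * ((2 / β) ^ n * ε n) := by
      rw [div_pow]
      push_cast
      field_simp
    rw [mul_add, mul_add, ← e1, ← e2, ← e3]
    have hsqrt' : _ ≤ √(2 / (1 - √r) * chainingSquareSum v m (√r) n) := hsqrt
    linarith

/-- Marcinkiewicz–Zygmund strong law for nonnegative pairwise negatively quadrant dependent
random variables with dominated tails. -/
theorem ae_tendsto_sum_range_div_rpow_of_nonneg [IsProbabilityMeasure μ] {p : ℝ} (hp1 : 1 < p)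
    (hp2 : p < 2) {V : ℕ → Ω → ℝ} {Y : Ω → ℝ} {C : ℝ} (hC : 0 ≤ C)
    (hV : ∀ i, Measurable (V i)) (hV0 : ∀ i ω, 0 ≤ V i ω)
    (hY : Measurable Y) (hY0 : ∀ ω, 0 ≤ Y ω) (hYp : Integrable (fun ω => Y ω ^ p) μ)
    (hneg : ∀ i j, i ≠ j → ∀ s t : ℝ, 0 < s → 0 < t →
      μ {ω | s < V i ω ∧ t < V j ω} ≤ μ {ω | s < V i ω} * μ {ω | t < V j ω})
    (hdom : ∀ i, ∀ t : ℝ, 0 < t → μ {ω | t < V i ω} ≤ ENNReal.ofReal C * μ {ω | t < Y ω}) :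
    (∀ i, Integrable (V i) μ) ∧ ∀ᵐ ω ∂μ, Tendsto
      (fun n : ℕ => (∑ i ∈ Finset.range n, (V i ω - ∫ ω', V i ω' ∂μ)) / (n : ℝ) ^ (1 / p))
      atTop (𝓝 0) := by
  have hYi := integrable_of_integrable_rpow hp1 hY hY0 hYp
  have hVi (i : ℕ) : Integrable (V i) μ :=
    integrable_of_tail_le (hV i) hY (hV0 i) hY0 hC (hdom i) hYi
  refine ⟨hVi, ?_⟩
  have hβ := one_lt_two_rpow_inv hp1
  have hβ2 := two_lt_two_rpow_inv_sq hp1 hp2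
  have hgs := (summable_integral_min_sq hp1 hp2 hY hY0 hYp).mul_left C
  have hεs := (summable_integral_posPart_sub hp1 hY hY0 hYp).mul_left C
  simp only [mul_left_comm C] at hgs hεs
  have hmono {n j : ℕ} (h : 2 ^ n ≤ j) : ((2 : ℝ) ^ (1 / p)) ^ n ≤ (j : ℝ) ^ (1 / p) := by
    rw [← Real.rpow_natCast, ← Real.rpow_mul (by norm_num), mul_comm, Real.rpow_mul (by norm_num),
      Real.rpow_natCast]
    exact Real.rpow_le_rpow (by positivity) (by exact_mod_cast h) (by positivity)
  set β : ℝ := 2 ^ (1 / p)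
  have hβ0 : 0 < β := by linarith
  filter_upwards [ae_exists_bound_sum_range hV hV0 hVi hneg hβ hβ2
    (fun k i => integral_min_sq_le_of_tail_le (hV i) hY (hV0 i) hY0 hC (hdom i)
      (pow_nonneg hβ0.le k)) hgs
    (fun k i => integral_posPart_sub_le_of_tail_le (hV i) hY (hV0 i) hY0 hC (hdom i) hYi
      (pow_nonneg hβ0.le k)) hεs] with ω hω
  obtain ⟨R, hR, hbound⟩ := hω
  -- Each j ≥ 1 is treated with the n for which 2^(n-1) ≤ j < 2^n; then β^n ≤ β j^(1/p), so only a
  -- factor β is lost.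
  have hlog : Tendsto (fun j : ℕ => Nat.log 2 j + 1) atTop atTop := by
    refine tendsto_atTop.2 fun b => ?_
    filter_upwards [eventually_ge_atTop (2 ^ b)] with j hj
    exact (Nat.le_log_of_pow_le one_lt_two hj).trans (Nat.le_succ _)
  have hlim : Tendsto (fun j : ℕ => β * R (Nat.log 2 j + 1)) atTop (𝓝 0) := by
    simpa using (hR.comp hlog).const_mul β
  refine squeeze_zero_norm' ?_ hlim
  filter_upwards [hlog.eventually hbound, eventually_ge_atTop 1] with j hj hj1
  have h1 := hj j (Nat.lt_pow_succ_log_self one_lt_two j)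
  have h2 := hmono (Nat.pow_log_le_self 2 (Nat.one_le_iff_ne_zero.1 hj1))
  have hR0 : 0 ≤ R (Nat.log 2 j + 1) :=
    nonneg_of_mul_nonneg_right ((abs_nonneg _).trans h1) (by positivity)
  have hjp : 0 < (j : ℝ) ^ (1 / p) := by positivity
  rw [norm_div, Real.norm_eq_abs, Real.norm_of_nonneg hjp.le, div_le_iff₀ hjp]
  calc _ ≤ β ^ (Nat.log 2 j + 1) * R (Nat.log 2 j + 1) := h1
    _ = β * R (Nat.log 2 j + 1) * β ^ Nat.log 2 j := by ring
    _ ≤ _ := by gcongr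

end strongLaw

/-! ### From quadrant dependence to tails, and the final reduction -/

section reduction

variable {Ω : Type*} [MeasurableSpace Ω] {μ : Measure Ω} [IsProbabilityMeasure μ]

/-- Strict inequalities are what negative parts require, as t < -X means X < -t. They follow by
continuity from below along x - 1/(n+1), y - 1/(n+1). -/
lemma measure_lt_and_lt_le_of_nqd {U V : Ω → ℝ}
    (h : ∀ x y : ℝ, μ.real {ω | U ω ≤ x ∧ V ω ≤ y} -
      μ.real {ω | U ω ≤ x} * μ.real {ω | V ω ≤ y} ≤ 0)
    (x y : ℝ) : μ {ω | U ω < x ∧ V ω < y} ≤ μ {ω | U ω < x} * μ {ω | V ω < y} := by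
  have h' (x y : ℝ) : μ {ω | U ω ≤ x ∧ V ω ≤ y} ≤ μ {ω | U ω ≤ x} * μ {ω | V ω ≤ y} := by
    rw [← ENNReal.toReal_le_toReal (measure_ne_top _ _)
      (ENNReal.mul_ne_top (measure_ne_top _ _) (measure_ne_top _ _)), ENNReal.toReal_mul]
    exact sub_nonpos.1 (h x y)
  have hlt {z x : ℝ} (hz : z < x) : ∃ n : ℕ, ∀ k ≥ n, z ≤ x - 1 / (k + 1 : ℝ) := by
    obtain ⟨n, hn⟩ := exists_nat_one_div_lt (sub_pos.2 hz)
    refine ⟨n, fun k hk => ?_⟩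
    have := Nat.one_div_le_one_div (α := ℝ) hk
    linarith
  have hmono : Monotone fun n : ℕ =>
      {ω | U ω ≤ x - 1 / (n + 1 : ℝ) ∧ V ω ≤ y - 1 / (n + 1 : ℝ)} := by
    intro a b hab ω hω
    have := Nat.one_div_le_one_div (α := ℝ) hab
    exact ⟨hω.1.trans (by linarith), hω.2.trans (by linarith)⟩
  have hUnion : {ω | U ω < x ∧ V ω < y}
      = ⋃ n : ℕ, {ω | U ω ≤ x - 1 / (n + 1 : ℝ) ∧ V ω ≤ y - 1 / (n + 1 : ℝ)} := by
    ext ω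
    simp only [Set.mem_ofPred_eq, Set.mem_iUnion]
    constructor
    · rintro ⟨h1, h2⟩
      obtain ⟨a, ha⟩ := hlt h1
      obtain ⟨b, hb⟩ := hlt h2
      exact ⟨max a b, ha _ (le_max_left _ _), hb _ (le_max_right _ _)⟩
    · rintro ⟨n, h1, h2⟩
      have : (0 : ℝ) < 1 / (n + 1 : ℝ) := by positivity
      exact ⟨by linarith, by linarith⟩
  rw [hUnion, hmono.measure_iUnion]
  refine iSup_le fun n => (h' _ _).trans ?_
  have hn : (0 : ℝ) < 1 / (n + 1 : ℝ) := by positivity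
  gcongr with ω ω
  · linarith
  · linarith

/-- Passing to complements, inclusion–exclusion gives the upper and lower quadrants the same defect
P(A ∩ B) - P(A)P(B). -/
lemma measure_gt_and_gt_le_of_nqd {U V : Ω → ℝ} (hU : Measurable U) (hV : Measurable V)
    (h : ∀ x y : ℝ, μ.real {ω | U ω ≤ x ∧ V ω ≤ y} -
      μ.real {ω | U ω ≤ x} * μ.real {ω | V ω ≤ y} ≤ 0)
    (x y : ℝ) : μ {ω | x < U ω ∧ y < V ω} ≤ μ {ω | x < U ω} * μ {ω | y < V ω} := by
  have hA : MeasurableSet {ω | U ω ≤ x} := measurableSet_le hU measurable_const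
  have hB : MeasurableSet {ω | V ω ≤ y} := measurableSet_le hV measurable_const
  have h1 : {ω | x < U ω} = {ω | U ω ≤ x}ᶜ := by ext; simp
  have h2 : {ω | y < V ω} = {ω | V ω ≤ y}ᶜ := by ext; simp
  have h3 : {ω | x < U ω ∧ y < V ω} = ({ω | U ω ≤ x} ∪ {ω | V ω ≤ y})ᶜ := by ext; simp
  rw [← ENNReal.toReal_le_toReal (measure_ne_top _ _)
      (ENNReal.mul_ne_top (measure_ne_top _ _) (measure_ne_top _ _)), ENNReal.toReal_mul]
  change μ.real _ ≤ μ.real _ * μ.real _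
  rw [h1, h2, h3, probReal_compl_eq_one_sub hA, probReal_compl_eq_one_sub hB,
    probReal_compl_eq_one_sub (hA.union hB)]
  have h4 := measureReal_union_add_inter (μ := μ) (s := {ω | U ω ≤ x}) hB
  have h5 : μ.real ({ω | U ω ≤ x} ∩ {ω | V ω ≤ y}) ≤ _ := sub_nonpos.1 (h x y)
  linarith

lemma one_le_LLog (x : ℝ) : 1 ≤ LLog x := by
  have h1 : Real.exp 1 ≤ Real.log (max x (Real.exp (Real.exp 1))) :=
    (Real.le_log_iff_exp_le (lt_max_of_lt_right (Real.exp_pos _))).2 (le_max_right _ _)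
  exact (Real.le_log_iff_exp_le ((Real.exp_pos _).trans_le h1)).2 h1

end reduction

theorem corollary1 {Ω : Type*} [MeasurableSpace Ω] (μ : Measure Ω) [IsProbabilityMeasure μ]
    (p : ℝ) (hp1 : 1 < p) (hp2 : p < 2)
    (X : ℕ → Ω → ℝ) (hX : ∀ n : ℕ, 1 ≤ n → Measurable (X n))
    (Y : Ω → ℝ) (hY : Measurable Y) (hYp : Integrable (fun ω => |Y ω| ^ p) μ)
    (hNQD : PairwiseNQD μ X) (hdom : StochDominatedBy μ X Y) :
    (∀ n : ℕ, 1 ≤ n → Integrable (X n) μ) ∧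
    ∀ᵐ ω ∂μ, Tendsto
      (fun n : ℕ =>
        1 / ((n : ℝ) ^ (1 / p) * LLog (n : ℝ) ^ (2 * (p - 1) / p)) *
          ∑ k ∈ Finset.Icc 1 n, (X k ω - ∫ ω', X k ω' ∂μ))
      atTop (𝓝 0) := by
  obtain ⟨C, hC, hdom⟩ := hdom
  have hX' (i : ℕ) : Measurable (X (i + 1)) := hX _ (Nat.le_add_left 1 i)
  have hNQD' (i j : ℕ) (hij : i ≠ j) :=
    hNQD (i + 1) (j + 1) (Nat.le_add_left 1 i) (Nat.le_add_left 1 j) (by omega)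
  have hdom' (i : ℕ) (t : ℝ) (ht : 0 < t) :
      μ {ω | t < |X (i + 1) ω|} ≤ ENNReal.ofReal C * μ {ω | t < |Y ω|} := by
    rw [← ENNReal.toReal_le_toReal (measure_ne_top _ _)
      (ENNReal.mul_ne_top ENNReal.ofReal_ne_top (measure_ne_top _ _)), ENNReal.toReal_mul,
      ENNReal.toReal_ofReal hC.le]
    exact hdom t ht (i + 1) (Nat.le_add_left 1 i)
  have hpos (x t : ℝ) (ht : 0 < t) : t < max x 0 ↔ t < x := by
    simp [ht.not_gt]
  obtain ⟨hi1, hlim1⟩ := ae_tendsto_sum_range_div_rpow_of_nonneg hp1 hp2 hC.le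
    (V := fun i ω => max (X (i + 1) ω) 0) (fun i => (hX' i).max measurable_const)
    (fun i ω => le_max_right _ _) (measurable_norm.comp hY) (fun ω => abs_nonneg (Y ω)) hYp
    (fun i j hij s t hs ht => by
      simp only [hpos _ _ hs, hpos _ _ ht]
      exact measure_gt_and_gt_le_of_nqd (hX' i) (hX' j) (hNQD' i j hij) s t)
    (fun i t ht => by
      refine le_trans (measure_mono fun ω hω => ?_) (hdom' i t ht)
      exact ((hpos _ _ ht).1 hω).trans_le (le_abs_self _))
  obtain ⟨hi2, hlim2⟩ := ae_tendsto_sum_range_div_rpow_of_nonneg hp1 hp2 hC.le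
    (V := fun i ω => max (-X (i + 1) ω) 0) (fun i => (hX' i).neg.max measurable_const)
    (fun i ω => le_max_right _ _) (measurable_norm.comp hY) (fun ω => abs_nonneg (Y ω)) hYp
    (fun i j hij s t hs ht => by
      simp only [hpos _ _ hs, hpos _ _ ht, lt_neg (b := X _ _)]
      exact measure_lt_and_lt_le_of_nqd (hNQD' i j hij) (-s) (-t))
    (fun i t ht => by
      refine le_trans (measure_mono fun ω hω => ?_) (hdom' i t ht)
      exact ((hpos _ _ ht).1 hω).trans_le (neg_le_abs _))
  have hsplit (i : ℕ) (ω : Ω) : X (i + 1) ω = max (X (i + 1) ω) 0 - max (-X (i + 1) ω) 0 := by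
    rcases le_total 0 (X (i + 1) ω) with h | h
    · simp [h]
    · simp [h]
  have hint (i : ℕ) : Integrable (X (i + 1)) μ :=
    ((hi1 i).sub (hi2 i)).congr (Eventually.of_forall fun ω => (hsplit i ω).symm)
  have hmean (i : ℕ) : ∫ ω, X (i + 1) ω ∂μ
      = ∫ ω, max (X (i + 1) ω) 0 ∂μ - ∫ ω, max (-X (i + 1) ω) 0 ∂μ := by
    rw [← integral_sub (hi1 i) (hi2 i)]
    exact integral_congr_ae (Eventually.of_forall fun ω => hsplit i ω)
  refine ⟨fun n hn => ?_, ?_⟩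
  · obtain ⟨i, rfl⟩ := Nat.exists_eq_add_of_le' hn
    exact hint i
  filter_upwards [hlim1, hlim2] with ω h1 h2
  have hlim : Tendsto (fun n : ℕ =>
      (∑ k ∈ Finset.Icc 1 n, (X k ω - ∫ ω', X k ω' ∂μ)) / (n : ℝ) ^ (1 / p)) atTop (𝓝 0) := by
    have h3 := h1.sub h2
    rw [sub_zero] at h3
    refine h3.congr fun n => ?_
    rw [← sub_div, ← Finset.sum_sub_distrib, Finset.range_eq_Ico,
      ← Finset.Ico_succ_right_eq_Icc, Nat.succ_eq_succ,
      ← Finset.sum_Ico_add' (fun k => X k ω - ∫ ω', X k ω' ∂μ) 0 n 1]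
    congr 1
    refine Finset.sum_congr rfl fun i _ => ?_
    rw [hmean i]
    linarith [hsplit i ω]
  -- The `LLog` power is at least 1 because its exponent is nonnegative, so dividing by it only
  -- decreases the norm.
  refine squeeze_zero_norm (fun n => ?_) (tendsto_zero_iff_norm_tendsto_zero.1 hlim)
  have hn : (0 : ℝ) ≤ (n : ℝ) ^ (1 / p) := by positivity
  have hL : 1 ≤ LLog (n : ℝ) ^ (2 * (p - 1) / p) :=
    Real.one_le_rpow (one_le_LLog _) (div_nonneg (by linarith) (by linarith))
  rw [one_div_mul_eq_div, ← div_div, norm_div]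
  exact div_le_self (norm_nonneg _) (hL.trans (le_abs_self _))
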